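/- Write $\mathbb{N}$ for the set of positive integers and $\mathbb{N}_0=\mathbb{N}\cup\{0\}$. A commutative semiring is a non-empty set $S$ with two operations $+$ and $\cdot$ such that $S(+)$ and $S(\cdot)$ are commutative semigroups and $\cdot$ distributes over $+$ (neither a zero nor a unity is required). Semiring homomorphisms are maps preserving $+$ and $\cdot$; a factor of a semiring is a homomorphic image of it. An element $a$ of a commutative semigroup $A(+)$ is called torsion if the set $\{\ell a : \ell\in\mathbb{N}\}$ is finite; regular if $a=a+b+a$ for some $b\in A$; strongly almost-divisible if there is an infinite set $P$ of primes such that for every $p\in P$ there is $c\in A$ with $a=pc$; almost-divisible if $ka$ is strongly almost-divisible for some $k\in\mathbb{N}$. The semigroup $A$ has one of these properties if all of its elements have it. For a submonoid $\mathcal{C}$ of $\mathbb{N}_0^n(+)$ let $$\mathbb{N}[\mathcal{C}]=\Big\{\sum_{i=1}^m k_i\, x^{\alpha_i} : m\in\mathbb{N},\ k_i\in\mathbb{N},\ \alpha_i\in\mathcal{C}\Big\}\subseteq\mathbb{Z}[x_1,\dots,x_n].$$ For a set $P$ of primes let $\mathbb{N}_P\subseteq\mathbb{Q}$ be the semiring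 of all fractions $k/m$ with $k\in\mathbb{N}$ and $m$ a (finite, possibly empty) product of primes from $P$, repetitions being allowed. **Theorem.** Let $n\in\mathbb{N}_0$, let $\mathcal{C}$ be a submonoid of $\mathbb{N}_0^n(+)$, and let the semiring $S$ be a factor of $\mathbb{N}[\mathcal{C}]$. Then: (i) $S(+)$ is almost-divisible if and only if $S(+)$ is torsion. (ii) $S(+)$ is strongly almost-divisible if and only if $S(+)$ is both regular and torsion. (iii) For every infinite set $P$ of primes, $S$ contains no subsemiring isomorphic to $\mathbb{N}_P$. Moreover, for every commutative semiring $T$ with a unity that is finitely generated as a semiring, $T(+)$ is torsion if and only if $T(+)$ is almost-divisible. -/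

import Mathlib

/-! Semirings here need neither a zero nor a unity: a commutative semiring is a type with
`[AddCommSemigroup S] [CommSemigroup S] [LeftDistribClass S] [RightDistribClass S]`. -/

namespace AlmostDiv

section Semigroup

/-- The multiple `n a = a + ⋯ + a` (`n ≥ 1` summands) in an additive semigroup. -/
def mult {A : Type*} [Add A] (n : ℕ+) (a : A) : A :=
  Nat.rec a (fun _ x => x + a) n.natPred

theorem mult_one {A : Type*} [Add A] (a : A) : mult 1 a = a := rfl

theorem mult_add_one {A : Type*} [Add A] (n : ℕ+) (a : A) :
    mult (n + 1) a = mult n a + a := by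
  have h : (n + 1).natPred = n.natPred + 1 := by
    have := PNat.natPred_add_one n
    simp only [PNat.natPred, PNat.add_coe, PNat.one_coe] at *
    omega
  simp only [mult, h]

theorem mult_eq_nsmul {A : Type*} [AddMonoid A] (n : ℕ+) (a : A) :
    mult n a = (n : ℕ) • a := by
  induction n using PNat.recOn with
  | one => simp [mult_one]
  | succ n ih => rw [mult_add_one, ih, PNat.add_coe, PNat.one_coe, succ_nsmul]

variable {A : Type*} [AddCommSemigroup A]

/-- `a` is torsion: the set of its positive multiples is finite. -/
def IsTorsionElem (a : A) : Prop :=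
  (Set.range fun l : ℕ+ => mult l a).Finite

/-- `a` is (von Neumann) regular in the additive semigroup. -/
def IsRegularElem (a : A) : Prop :=
  ∃ b : A, a = a + b + a

/-- `a` is divisible by every prime from some infinite set of primes. -/
def IsStronglyAlmostDivisibleElem (a : A) : Prop :=
  ∃ P : Set Nat.Primes, P.Infinite ∧ ∀ p ∈ P, ∃ c : A, a = mult (p : ℕ+) c

/-- Some positive multiple of `a` is strongly almost-divisible. -/
def IsAlmostDivisibleElem (a : A) : Prop :=
  ∃ k : ℕ+, IsStronglyAlmostDivisibleElem (mult k a)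

variable (A)

/-- The additive semigroup `A` is torsion. -/
def AddTorsion : Prop := ∀ a : A, IsTorsionElem a

/-- The additive semigroup `A` is regular. -/
def AddRegular : Prop := ∀ a : A, IsRegularElem a

/-- The additive semigroup `A` is strongly almost-divisible. -/
def AddStronglyAlmostDivisible : Prop := ∀ a : A, IsStronglyAlmostDivisibleElem a

/-- The additive semigroup `A` is almost-divisible. -/
def AddAlmostDivisible : Prop := ∀ a : A, IsAlmostDivisibleElem a

end Semigroup

/-- A homomorphism of semirings (no zero or unity is assumed to exist or be preserved). -/
structure IsSemiringHom {A B : Type*} [Add A] [Mul A] [Add B] [Mul B] (f : A → B) : Prop where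
  map_add : ∀ x y, f (x + y) = f x + f y
  map_mul : ∀ x y, f (x * y) = f x * f y

/-- `S` is a factor (homomorphic image, i.e. quotient by a congruence up to isomorphism) of `R`. -/
def IsFactorOf (S R : Type*) [Add S] [Mul S] [Add R] [Mul R] : Prop :=
  ∃ f : R → S, IsSemiringHom f ∧ Function.Surjective f

/-- `S` contains (an isomorphic copy of) the semiring `R` as a subsemiring. -/
def ContainsCopyOf (S R : Type*) [Add S] [Mul S] [Add R] [Mul R] : Prop :=
  ∃ f : R → S, IsSemiringHom f ∧ Function.Injective f

/-- `S` is finitely generated as a semiring: for some finite set `X`, the only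
subset of `S` containing `X` and closed under addition and multiplication is `S` itself. -/
def FinGenSemiring (S : Type*) [Add S] [Mul S] : Prop :=
  ∃ X : Set S, X.Finite ∧ ∀ T : Set S, X ⊆ T →
    (∀ x ∈ T, ∀ y ∈ T, x + y ∈ T) → (∀ x ∈ T, ∀ y ∈ T, x * y ∈ T) → T = Set.univ

section MonoidSemiring

variable {n : ℕ} (C : AddSubmonoid (Fin n →₀ ℕ))

/-- The finite nonempty sums of monomials `x ^ α`, `α ∈ C`, in `ℤ[x₁, …, xₙ]`.
In particular the zero polynomial is not included. -/
noncomputable def monoidSemiringSet : AddSubsemigroup (MvPolynomial (Fin n) ℤ) :=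
  AddSubsemigroup.closure ((fun α => MvPolynomial.monomial α (1 : ℤ)) '' (C : Set (Fin n →₀ ℕ)))

theorem monoidSemiringSet_mul_mem {f g : MvPolynomial (Fin n) ℤ}
    (hf : f ∈ monoidSemiringSet C) (hg : g ∈ monoidSemiringSet C) :
    f * g ∈ monoidSemiringSet C := by
  unfold monoidSemiringSet at *
  induction hf using AddSubsemigroup.closure_induction with
  | mem x hx =>
    induction hg using AddSubsemigroup.closure_induction with
    | mem y hy =>
      obtain ⟨a, ha, rfl⟩ := hx
      obtain ⟨b, hb, rfl⟩ := hy
      refine AddSubsemigroup.subset_closure ⟨a + b, C.add_mem ha hb, ?_⟩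
      simp [MvPolynomial.monomial_mul]
    | add y z _ _ hy hz => rw [mul_add]; exact add_mem hy hz
  | add x y _ _ hx hy => rw [add_mul]; exact add_mem hx hy

/-- The explicit description of the monoid semiring as the set of all sums
`∑ i, k i * x ^ α i` over a nonempty finite index set, with positive integers `k i`
and `α i ∈ C`. -/
theorem mem_monoidSemiringSet_iff (f : MvPolynomial (Fin n) ℤ) :
    f ∈ monoidSemiringSet C ↔ ∃ (m : ℕ) (k : Fin (m + 1) → ℕ+) (α : Fin (m + 1) → C),
      f = ∑ i, MvPolynomial.monomial (α i : Fin n →₀ ℕ) ((k i : ℕ) : ℤ) := by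
  constructor
  · intro hf
    unfold monoidSemiringSet at hf
    induction hf using AddSubsemigroup.closure_induction with
    | mem x hx =>
      obtain ⟨a, ha, rfl⟩ := hx
      exact ⟨0, fun _ => 1, fun _ => ⟨a, ha⟩, by simp⟩
    | add x y _ _ hx hy =>
      obtain ⟨m, k, α, rfl⟩ := hx
      obtain ⟨m', k', α', rfl⟩ := hy
      refine ⟨m + 1 + m', (Fin.append k k' : Fin (m + 1 + (m' + 1)) → ℕ+),
        (Fin.append α α' : Fin (m + 1 + (m' + 1)) → C), ?_⟩
      have := Fin.sum_univ_add (a := m + 1) (b := m' + 1) (fun i =>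
        MvPolynomial.monomial ((Fin.append α α' i : C) : Fin n →₀ ℕ)
          (((Fin.append k k' i : ℕ+) : ℕ) : ℤ))
      simp only [Fin.append_left, Fin.append_right] at this
      exact this.symm
  · rintro ⟨m, k, α, rfl⟩
    have mono : ∀ (a : C) (j : ℕ+),
        MvPolynomial.monomial (a : Fin n →₀ ℕ) ((j : ℕ) : ℤ) ∈ monoidSemiringSet C := by
      intro a j
      induction j using PNat.recOn with
      | one => exact AddSubsemigroup.subset_closure ⟨a, a.2, by simp⟩
      | succ j ih =>
        rw [PNat.add_coe, Nat.cast_add, map_add]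
        exact add_mem ih (AddSubsemigroup.subset_closure ⟨a, a.2, by simp⟩)
    induction m with
    | zero => simpa using mono (α 0) (k 0)
    | succ m ih =>
      rw [Fin.sum_univ_castSucc]
      exact add_mem (ih _ _) (mono _ _)

/-- The monoid semiring `ℕ[C]` (with `ℕ` the positive integers). -/
noncomputable def MonoidSemiring : Type :=
  {f : MvPolynomial (Fin n) ℤ // f ∈ monoidSemiringSet C}

noncomputable instance : Add (MonoidSemiring C) := ⟨fun f g => ⟨f.1 + g.1, add_mem f.2 g.2⟩⟩

noncomputable instance : Mul (MonoidSemiring C) := ⟨fun f g => ⟨f.1 * g.1, monoidSemiringSet_mul_mem C f.2 g.2⟩⟩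

noncomputable instance : AddCommSemigroup (MonoidSemiring C) :=
  Function.Injective.addCommSemigroup Subtype.val Subtype.val_injective fun _ _ => rfl

noncomputable instance : CommSemigroup (MonoidSemiring C) :=
  Function.Injective.commSemigroup Subtype.val Subtype.val_injective fun _ _ => rfl

instance : LeftDistribClass (MonoidSemiring C) :=
  ⟨fun a b c => Subtype.ext (mul_add a.1 b.1 c.1)⟩

instance : RightDistribClass (MonoidSemiring C) :=
  ⟨fun a b c => Subtype.ext (add_mul a.1 b.1 c.1)⟩

end MonoidSemiring

section PrimeFractions

variable (P : Set Nat.Primes)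

/-- The products of (finitely many, possibly repeated) primes from `P`. -/
def primeProducts : Submonoid ℕ :=
  Submonoid.closure ((fun p : Nat.Primes => (p : ℕ)) '' P)

theorem primeProducts_pos {m : ℕ} (hm : m ∈ primeProducts P) : 0 < m := by
  unfold primeProducts at hm
  induction hm using Submonoid.closure_induction with
  | mem x hx => obtain ⟨p, _, rfl⟩ := hx; exact p.2.pos
  | one => exact one_pos
  | mul x y _ _ hx hy => exact Nat.mul_pos hx hy

/-- The semiring `ℕ_P` of all fractions `k / m`, where `k` is a positive integer and `m` is a
product of primes from `P`. -/
def PrimeFractions : Type :=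
  {q : ℚ // ∃ k m : ℕ, 0 < k ∧ m ∈ primeProducts P ∧ q = (k : ℚ) / (m : ℚ)}

instance : Add (PrimeFractions P) := ⟨fun x y => ⟨x.1 + y.1, by
  obtain ⟨k, m, hk, hm, hx⟩ := x.2
  obtain ⟨l, r, hl, hr, hy⟩ := y.2
  have hm0 : (m : ℚ) ≠ 0 := by exact_mod_cast (primeProducts_pos P hm).ne'
  have hr0 : (r : ℚ) ≠ 0 := by exact_mod_cast (primeProducts_pos P hr).ne'
  refine ⟨k * r + m * l, m * r, ?_, mul_mem hm hr, ?_⟩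
  · have := Nat.mul_pos hk (primeProducts_pos P hr)
    omega
  · rw [hx, hy, div_add_div _ _ hm0 hr0]
    push_cast
    rfl⟩⟩

instance : Mul (PrimeFractions P) := ⟨fun x y => ⟨x.1 * y.1, by
  obtain ⟨k, m, hk, hm, hx⟩ := x.2
  obtain ⟨l, r, hl, hr, hy⟩ := y.2
  refine ⟨k * l, m * r, Nat.mul_pos hk hl, mul_mem hm hr, ?_⟩
  rw [hx, hy, div_mul_div_comm]
  push_cast
  rfl⟩⟩

instance : AddCommSemigroup (PrimeFractions P) :=
  Function.Injective.addCommSemigroup Subtype.val Subtype.val_injective fun _ _ => rfl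

instance : CommSemigroup (PrimeFractions P) :=
  Function.Injective.commSemigroup Subtype.val Subtype.val_injective fun _ _ => rfl

instance : LeftDistribClass (PrimeFractions P) :=
  ⟨fun a b c => Subtype.ext (mul_add a.1 b.1 c.1)⟩

instance : RightDistribClass (PrimeFractions P) :=
  ⟨fun a b c => Subtype.ext (add_mul a.1 b.1 c.1)⟩

end PrimeFractions

end AlmostDiv

universe u

namespace AlmostDiv

/-! Both kinds of semiring have a unity and are additively generated by the image of a monoid
embedded in a finitely generated abelian group. Everything reduces to idempotents: if a multiple of
an idempotent `e` is divisible by infinitely many primes, then `e` is torsion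
(`exists_nsmul_add_nsmul_eq`). Suppose `e` is not torsion. The elements `s` with `e * s` a summand
of a multiple of `e` form a subsemiring, closed under summands and containing every divisor of a
multiple of `e`. Its Grothendieck ring has a homomorphism to a field of characteristic zero sending
`e` to `1` (`exists_ringHom_charZero_field`). The image lies in a finitely generated ring
(`exists_finite_range_subset_adjoin`), yet contains `k / p` for a fixed `k ≠ 0` and infinitely many
primes `p`; specialising to a number field rules this out (`eq_zero_of_infinite_div_mem_adjoin`).
With `e = 1`, torsion spreads to all elements; with `e` the image of the unity of `ℕ_P`, no copy of
`ℕ_P` exists. The regularity statement is then arithmetic of multiples. -/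

theorem eq_zero_of_infinite_dvd {P : Set Nat.Primes} (hP : P.Infinite) (k : ℤ)
    (h : ∀ p ∈ P, ((p : ℕ) : ℤ) ∣ k) : k = 0 := by
  by_contra hk
  refine hP (Set.Finite.subset (Set.Finite.preimage (f := fun p : Nat.Primes => (p : ℕ))
    (Nat.Primes.coe_nat_injective.injOn) (Set.finite_Iic k.natAbs)) fun p hp => ?_)
  exact Nat.le_of_dvd (Int.natAbs_pos.2 hk) (Int.natCast_dvd.1 (h p hp))

/-! ### Finitely generated rings of characteristic zero -/

/-- A nonzero algebra of finite type over `ℚ` has a point over a number field. -/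
theorem exists_algHom_finite_field (B : Type u) [CommRing B] [Nontrivial B] [Algebra ℚ B]
    [Algebra.FiniteType ℚ B] : ∃ (L : Type u) (_ : Field L) (_ : Algebra ℚ L)
      (_ : Module.Finite ℚ L), Nonempty (B →ₐ[ℚ] L) := by
  obtain ⟨m, hm⟩ := Ideal.exists_maximal B
  -- Zariski's lemma: the residue field is finite over `ℚ`.
  exact ⟨B ⧸ m, Ideal.Quotient.field m, Ideal.Quotient.algebra ℚ,
    @finite_of_finite_type_of_isJacobsonRing ℚ (B ⧸ m) _ (Ideal.Quotient.field m) _ _ _,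
    ⟨Ideal.Quotient.mkₐ ℚ m⟩⟩

/-- In a finitely generated subring of a field of characteristic zero, a nonzero integer is
divisible by only finitely many primes. -/
theorem eq_zero_of_infinite_div_mem_adjoin {K : Type*} [Field K] [CharZero K] {X : Set K}
    (hX : X.Finite) {P : Set Nat.Primes} (hP : P.Infinite) (k : ℤ)
    (h : ∀ p ∈ P, (k : K) / ((p : ℕ) : K) ∈ Algebra.adjoin ℤ X) : k = 0 := by
  let B := Algebra.adjoin ℚ X
  have : Algebra.FiniteType ℚ B :=
    B.fg_iff_finiteType.1 (Subalgebra.fg_def.2 ⟨X, hX, rfl⟩)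
  obtain ⟨L, _, _, _, ⟨f⟩⟩ := exists_algHom_finite_field B
  have := Algebra.IsAlgebraic.of_finite ℚ L
  have : Algebra.IsAlgebraic ℤ ℚ := IsLocalization.isAlgebraic ℚ (nonZeroDivisors ℤ)
  have : Algebra.IsAlgebraic ℤ L := Algebra.IsAlgebraic.trans ℤ ℚ L
  have hXB : ∀ x ∈ X, x ∈ B := fun x hx => Algebra.subset_adjoin hx
  have hfin : {y | ∃ b : B, (b : K) ∈ X ∧ f b = y}.Finite :=
    ((hX.preimage Subtype.val_injective.injOn).image f)
  -- `N` is a common denominator for the images of the generators; a polynomial in them needs a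
  -- power of `N`.
  obtain ⟨N, hN0, hN⟩ := Algebra.IsAlgebraic.exists_integral_multiples ℤ hfin.toFinset
  have key : ∀ x ∈ Algebra.adjoin ℤ X,
      ∃ (hx : x ∈ B) (j : ℕ), IsIntegral ℤ ((N : L) ^ j * f ⟨x, hx⟩) := by
    have hNint : ∀ j : ℕ, IsIntegral ℤ ((N : L) ^ j) := fun j =>
      (isIntegral_algebraMap (R := ℤ) (x := N)).pow j
    intro x hx
    induction hx using Algebra.adjoin_induction with
    | mem x hx =>
      refine ⟨hXB x hx, 1, ?_⟩
      have := hN (f ⟨x, hXB x hx⟩) (hfin.mem_toFinset.2 ⟨_, hx, rfl⟩)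
      simpa [zsmul_eq_mul] using this
    | algebraMap r =>
      refine ⟨by simp, 0, ?_⟩
      have : (⟨algebraMap ℤ K r, by simp⟩ : B) = (r : B) := by
        ext; simp
      rw [this, map_intCast, pow_zero, one_mul]
      exact isIntegral_algebraMap (R := ℤ) (x := r)
    | add x y _ _ ihx ihy =>
      obtain ⟨hx, i, hi⟩ := ihx
      obtain ⟨hy, j, hj⟩ := ihy
      refine ⟨add_mem hx hy, i + j, ?_⟩
      have : f ⟨x + y, add_mem hx hy⟩ = f ⟨x, hx⟩ + f ⟨y, hy⟩ := map_add f ⟨x, hx⟩ ⟨y, hy⟩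
      rw [this, show (N : L) ^ (i + j) * (f ⟨x, hx⟩ + f ⟨y, hy⟩) =
        N ^ j * (N ^ i * f ⟨x, hx⟩) + N ^ i * (N ^ j * f ⟨y, hy⟩) by ring]
      exact ((hNint j).mul hi).add ((hNint i).mul hj)
    | mul x y _ _ ihx ihy =>
      obtain ⟨hx, i, hi⟩ := ihx
      obtain ⟨hy, j, hj⟩ := ihy
      refine ⟨mul_mem hx hy, i + j, ?_⟩
      have : f ⟨x * y, mul_mem hx hy⟩ = f ⟨x, hx⟩ * f ⟨y, hy⟩ := map_mul f ⟨x, hx⟩ ⟨y, hy⟩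
      rw [this, show (N : L) ^ (i + j) * (f ⟨x, hx⟩ * f ⟨y, hy⟩) =
        (N ^ i * f ⟨x, hx⟩) * (N ^ j * f ⟨y, hy⟩) by ring]
      exact hi.mul hj
  have hNk : N * k = 0 := by
    refine eq_zero_of_infinite_dvd hP _ fun p hp => ?_
    obtain ⟨hx, j, hj⟩ := key _ (h p hp)
    have hp0 : ((p : ℕ) : ℚ) ≠ 0 := by exact_mod_cast p.2.ne_zero
    have e1 : (⟨(k : K) / ((p : ℕ) : K), hx⟩ : B) = algebraMap ℚ B (k / (p : ℕ)) := by
      ext; simp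
    have e2 : (N : L) ^ j * f ⟨(k : K) / ((p : ℕ) : K), hx⟩ =
        algebraMap ℚ L ((N : ℚ) ^ j * (k / (p : ℕ))) := by
      rw [e1, AlgHom.commutes, map_mul, map_pow, map_intCast]
    rw [e2, isIntegral_algebraMap_iff (algebraMap ℚ L).injective] at hj
    obtain ⟨z, hz⟩ := IsIntegrallyClosed.isIntegral_iff.1 hj
    have hz' : N ^ j * k = z * (p : ℕ) := by
      have : ((N ^ j * k : ℤ) : ℚ) = ((z * (p : ℕ) : ℤ) : ℚ) := by
        push_cast
        have : (z : ℚ) = N ^ j * (k / (p : ℕ)) := by simpa using hz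
        rw [this]; field_simp
      exact_mod_cast this
    have hp' : Prime ((p : ℕ) : ℤ) := Nat.prime_iff_prime_int.1 p.2
    -- A prime dividing `N` gives nothing about `k`, so the divisibility is stated for `N * k`.
    rcases hp'.dvd_or_dvd (Dvd.intro_left z hz'.symm) with h | h
    · exact (hp'.dvd_of_dvd_pow h).mul_right _
    · exact h.mul_left _
  exact (mul_eq_zero.1 hNk).resolve_left hN0

/-! ### Multiplicative maps to a field -/

/-- A multiplicative map from a submonoid of a finitely generated abelian group to a field has
image in a finitely generated subring. -/
theorem exists_finite_range_subset_adjoin {K V Γ : Type*} [Field K] [AddCommGroup V]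
    [Module.Finite ℤ V] [CommMonoid Γ] (j : Γ →* Multiplicative V) (hj : Function.Injective j)
    (φ : Γ →* K) : ∃ X : Set K, X.Finite ∧ ∀ γ, φ γ ∈ Algebra.adjoin ℤ X := by
  -- `Γ` need not be finitely generated, but the subgroup spanned by the elements with nonzero value
  -- is. There the map extends by fractions, so finitely many values and their inverses suffice.
  let F : Set V := (fun γ => (j γ).toAdd) '' {γ | φ γ ≠ 0}
  obtain ⟨F', hF', hspan⟩ := (Submodule.fg_span_iff_fg_span_finset_subset F).1
    (IsNoetherian.noetherian (Submodule.span ℤ F))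
  have hFin : {γ : Γ | (j γ).toAdd ∈ F'}.Finite :=
    Set.Finite.preimage (f := fun γ => (j γ).toAdd) (Multiplicative.toAdd.injective.comp hj).injOn
      F'.finite_toSet
  let X : Set K := φ '' {γ : Γ | (j γ).toAdd ∈ F'} ∪ (fun γ => (φ γ)⁻¹) '' {γ : Γ | (j γ).toAdd ∈ F'}
  have key : ∀ v ∈ Submodule.span ℤ (F' : Set V), ∃ a b : Γ, v = (j a).toAdd - (j b).toAdd ∧
      φ a ≠ 0 ∧ φ b ≠ 0 ∧ φ a ∈ Algebra.adjoin ℤ X ∧ φ b ∈ Algebra.adjoin ℤ X ∧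
      (φ a)⁻¹ ∈ Algebra.adjoin ℤ X ∧ (φ b)⁻¹ ∈ Algebra.adjoin ℤ X := by
    intro v hv
    rw [← Submodule.mem_toAddSubgroup, Submodule.span_int_eq_addSubgroupClosure] at hv
    induction hv using AddSubgroup.closure_induction with
    | mem x hx =>
      obtain ⟨γ, hγ, rfl⟩ := hF' hx
      exact ⟨γ, 1, by simp, hγ, by simp,
        Algebra.subset_adjoin (Or.inl ⟨γ, hx, rfl⟩), by simp [one_mem],
        Algebra.subset_adjoin (Or.inr ⟨γ, hx, rfl⟩), by simp [one_mem]⟩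
    | zero => exact ⟨1, 1, by simp, by simp, by simp, by simp [one_mem], by simp [one_mem],
        by simp [one_mem], by simp [one_mem]⟩
    | add x y _ _ hx hy =>
      obtain ⟨a, b, rfl, h1, h2, h3, h4, h5, h6⟩ := hx
      obtain ⟨c, d, rfl, g1, g2, g3, g4, g5, g6⟩ := hy
      refine ⟨a * c, b * d, ?_, ?_, ?_, ?_, ?_, ?_, ?_⟩
      · simp only [map_mul, toAdd_mul]; abel
      · rw [map_mul]; exact mul_ne_zero h1 g1
      · rw [map_mul]; exact mul_ne_zero h2 g2
      · rw [map_mul]; exact mul_mem h3 g3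
      · rw [map_mul]; exact mul_mem h4 g4
      · rw [map_mul, mul_inv]; exact mul_mem h5 g5
      · rw [map_mul, mul_inv]; exact mul_mem h6 g6
    | neg x _ hx =>
      obtain ⟨a, b, rfl, h1, h2, h3, h4, h5, h6⟩ := hx
      exact ⟨b, a, by abel, h2, h1, h4, h3, h6, h5⟩
  refine ⟨X, (hFin.image _).union (hFin.image _), fun γ => ?_⟩
  by_cases h0 : φ γ = 0
  · rw [h0]; exact zero_mem _
  · have hγ : (j γ).toAdd ∈ Submodule.span ℤ (F' : Set V) :=
      hspan ▸ Submodule.subset_span ⟨γ, h0, rfl⟩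
    obtain ⟨a, b, hab, _, hb, ha', _, _, hb'⟩ := key _ hγ
    have : γ * b = a := by
      apply hj
      rw [map_mul]
      apply Multiplicative.toAdd.injective
      rw [toAdd_mul, hab, sub_add_cancel]
    have : φ γ = φ a * (φ b)⁻¹ := by rw [← this, map_mul, mul_inv_cancel_right₀ hb]
    rw [this]
    exact mul_mem ha' hb'

/-! ### Characteristic-zero points of the Grothendieck ring -/

/-- An idempotent of a commutative semiring which is not torsion in the group of differences
is sent to `1` by a homomorphism to a field of characteristic zero. -/
theorem exists_ringHom_charZero_field {S : Type u} [CommSemiring S] {e : S} (he : e * e = e)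
    (h : ∀ m : ℕ, m ≠ 0 → ∀ s : S, m • e + s ≠ s) :
    ∃ (K : Type u) (_ : Field K) (_ : CharZero K) (g : S →+* K), g e = 1 := by
  let A := FreeAbelianGroup S
  let G := Algebra.GrothendieckAddGroup S
  let ι : S →+ G := Algebra.GrothendieckAddGroup.of
  let δ : S →* A := FreeAbelianGroup.ofMulHom
  let I : Ideal A := Ideal.span (Set.range fun x : S × S => δ (x.1 + x.2) - (δ x.1 + δ x.2))
  let L : A →+ G := FreeAbelianGroup.lift ι
  have hLδ : ∀ s, L (δ s) = ι s := fun s => FreeAbelianGroup.lift_apply_of _ _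
  -- `L` is only additive; quantifying over the multiplier `c` carries the induction through the
  -- ideal span.
  have hL' : ∀ x ∈ I, ∀ c, L (c * x) = 0 := by
    intro x hx
    induction hx using Submodule.span_induction with
    | mem x hx =>
      obtain ⟨⟨a, b⟩, rfl⟩ := hx
      intro c
      induction c using FreeAbelianGroup.induction_on with
      | zero => simp
      | of s =>
        change L (δ s * _) = 0
        rw [mul_sub, mul_add, ← map_mul, ← map_mul, ← map_mul, map_sub, map_add, hLδ, hLδ, hLδ,
          mul_add, map_add, sub_self]
      | neg s hs => rw [neg_mul, map_neg, hs, neg_zero]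
      | add x y hx hy => rw [add_mul, map_add, hx, hy, add_zero]
    | zero => simp
    | add x y _ _ hx hy => intro c; rw [mul_add, map_add, hx, hy, add_zero]
    | smul d x hx ih => intro c; rw [smul_eq_mul, ← mul_assoc, ih]
  have hL : ∀ x ∈ I, L x = 0 := fun x hx => one_mul x ▸ hL' x hx 1
  let q : A →+* A ⧸ I := Ideal.Quotient.mk I
  have hq : ∀ a b, q (δ (a + b)) = q (δ a) + q (δ b) := fun a b => by
    rw [← map_add, Ideal.Quotient.eq]
    exact Ideal.subset_span ⟨(a, b), rfl⟩
  let r : S →+* A ⧸ I :=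
    { toFun := fun s => q (δ s)
      map_one' := by simp
      map_mul' := by simp
      map_add' := hq
      map_zero' := by simpa using hq 0 0 }
  have hr : ∀ m : ℕ, m ≠ 0 → (m : A ⧸ I) * r e ≠ 0 := by
    intro m hm h0
    have h1 : q (m • δ e) = 0 := by
      rw [map_nsmul, nsmul_eq_mul]; exact h0
    have h2 : ι (m • e) = ι 0 := by
      rw [map_nsmul, ← hLδ, ← map_nsmul, hL _ (Ideal.Quotient.eq_zero_iff_mem.1 h1), map_zero]
    obtain ⟨c, hc⟩ := (AddLocalization.addMonoidOf (⊤ : AddSubmonoid S)).eq_iff_exists.1 h2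
    refine h m hm c ?_
    rw [add_comm, hc, add_zero]
  -- `T` contains the positive integers and `r e`. A prime avoiding `T` thus has a residue domain of
  -- characteristic zero in which the idempotent is nonzero, hence `1`.
  let T : Submonoid (A ⧸ I) :=
    { carrier := {x | ∃ m : ℕ, m ≠ 0 ∧ x * r e = m * r e}
      one_mem' := ⟨1, one_ne_zero, by simp⟩
      mul_mem' := by
        rintro x y ⟨m, hm, hx⟩ ⟨n, hn, hy⟩
        refine ⟨m * n, mul_ne_zero hm hn, ?_⟩
        rw [mul_assoc, hy, mul_left_comm, hx]
        push_cast; ring }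
  have hT : Disjoint ((⊥ : Ideal (A ⧸ I)) : Set (A ⧸ I)) T := by
    rw [Set.disjoint_left]
    rintro x hx ⟨m, hm, hxm⟩
    rw [SetLike.mem_coe, Ideal.mem_bot] at hx
    exact hr m hm (by rw [← hxm, hx, zero_mul])
  obtain ⟨Q, hQ, _, hQT⟩ := Ideal.exists_le_prime_disjoint ⊥ T hT
  let g : A ⧸ I →+* FractionRing ((A ⧸ I) ⧸ Q) :=
    (algebraMap _ _).comp (Ideal.Quotient.mk Q)
  have hg : ∀ x ∈ T, g x ≠ 0 := by
    intro x hx h0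
    refine Set.disjoint_left.1 hQT ?_ hx
    exact Ideal.Quotient.eq_zero_iff_mem.1 ((IsFractionRing.injective ((A ⧸ I) ⧸ Q)
      (FractionRing ((A ⧸ I) ⧸ Q))) (by rw [map_zero]; exact h0))
  refine ⟨FractionRing ((A ⧸ I) ⧸ Q), inferInstance, charZero_of_inj_zero fun n hn => ?_,
    g.comp r, ?_⟩
  · by_contra hn0
    exact hg n ⟨n, hn0, rfl⟩ (by rw [map_natCast, hn])
  · have h1 : g (r e) ≠ 0 := hg _ ⟨1, one_ne_zero, by rw [← map_mul, he]; simp⟩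
    apply mul_left_cancel₀ h1
    change g (r e) * g (r e) = _
    rw [← map_mul, ← map_mul, he, mul_one]

/-! ### Idempotents divisible by infinitely many primes -/

/-- An idempotent with a multiple divisible by infinitely many primes is torsion, in a commutative
semiring additively generated by the image of a submonoid of a finitely generated group. -/
theorem exists_nsmul_add_nsmul_eq {M V Γ : Type*} [CommSemiring M] [AddCommGroup V]
    [Module.Finite ℤ V] [CommMonoid Γ] (j : Γ →* Multiplicative V) (hj : Function.Injective j)
    (ψ : Γ →* M) (hψ : AddSubmonoid.closure (Set.range ψ) = ⊤) {e : M} (he : e * e = e)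
    {P : Set Nat.Primes} (hP : P.Infinite) {k : ℕ} (hk : k ≠ 0)
    (hdiv : ∀ p ∈ P, ∃ c : M, k • e = (p : ℕ) • c) :
    ∃ m N : ℕ, m ≠ 0 ∧ m • e + N • e = N • e := by
  by_contra! hcon
  let S : Subsemiring M :=
    { carrier := {s | ∃ (N : ℕ) (t : M), e * s + t = N • e}
      zero_mem' := ⟨0, 0, by simp⟩
      one_mem' := ⟨1, 0, by simp⟩
      add_mem' := by
        rintro a b ⟨N, t, h⟩ ⟨N', t', h'⟩
        refine ⟨N + N', t + t', ?_⟩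
        rw [add_nsmul, ← h, ← h']; ring
      mul_mem' := by
        rintro a b ⟨N, t, h⟩ ⟨N', t', h'⟩
        refine ⟨N * N', e * a * t' + t * (e * b) + t * t', ?_⟩
        have : (N * N') • e = (N • e) * (N' • e) := by
          rw [smul_mul_smul_comm, he]
        rw [this, ← h, ← h']
        have : e * (a * b) = (e * a) * (e * b) := by
          rw [mul_mul_mul_comm, he]
        rw [this]; ring }
  -- Closure under summands makes each element of `S` a sum of values of `ψ` that themselves lie in
  -- `S`.
  have hS : ∀ {a b : M}, a + b ∈ S → a ∈ S := by
    rintro a b ⟨N, t, h⟩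
    exact ⟨N, e * b + t, by rw [← h]; ring⟩
  have heS : e ∈ S := ⟨1, 0, by simp [he]⟩
  obtain ⟨K, _, _, g, hg⟩ := exists_ringHom_charZero_field (S := S) (e := ⟨e, heS⟩)
    (Subtype.ext he) (by
      rintro m hm ⟨s, N, t, hs⟩ h
      have h1 : m • e + s = s := congrArg Subtype.val h
      refine hcon m N hm ?_
      calc m • e + N • e = e * (m • e + s) + t := by
            rw [← hs, mul_add, mul_smul_comm, he, add_assoc]
        _ = N • e := by rw [h1, hs])
  let Γ' : Submonoid Γ := S.toSubmonoid.comap ψ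
  let φ : Γ' →* K := (g : S →* K).comp (ψ.submonoidComap S.toSubmonoid)
  obtain ⟨X, hX, hφ⟩ := exists_finite_range_subset_adjoin (j.comp Γ'.subtype)
    (hj.comp Subtype.val_injective) φ
  have hgX : ∀ s (hs : s ∈ S), g ⟨s, hs⟩ ∈ Algebra.adjoin ℤ X := by
    intro s
    have hs' : s ∈ AddSubmonoid.closure (Set.range ψ) := hψ ▸ AddSubmonoid.mem_top s
    induction hs' using AddSubmonoid.closure_induction with
    | mem x hx =>
      obtain ⟨γ, rfl⟩ := hx
      exact fun hs => hφ ⟨γ, hs⟩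
    | zero =>
      intro hs
      have : g ⟨0, hs⟩ = 0 := map_zero g
      rw [this]; exact zero_mem _
    | add x y _ _ hx hy =>
      intro hs
      have h1 : x ∈ S := hS hs
      have h2 : y ∈ S := hS (add_comm x y ▸ hs)
      have : g ⟨x + y, hs⟩ = g ⟨x, h1⟩ + g ⟨y, h2⟩ := map_add g ⟨x, h1⟩ ⟨y, h2⟩
      rw [this]
      exact add_mem (hx h1) (hy h2)
  refine hk (Int.natCast_eq_zero.1
    (eq_zero_of_infinite_div_mem_adjoin hX hP (k : ℤ) fun p hp => ?_))
  obtain ⟨c, hc⟩ := hdiv p hp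
  have hp0 : ((p : ℕ) : K) ≠ 0 := by exact_mod_cast p.2.ne_zero
  have hcS : c ∈ S := by
    refine ⟨k, ((p : ℕ) - 1) • (e * c), ?_⟩
    have : k • e = e * (k • e) := by rw [mul_smul_comm, he]
    rw [this, hc, mul_smul_comm, ← succ_nsmul', Nat.sub_add_cancel p.2.one_le]
  have h1 : k • (⟨e, heS⟩ : S) = (p : ℕ) • ⟨c, hcS⟩ := Subtype.ext hc
  have h2 := congrArg g h1
  rw [map_nsmul, map_nsmul, hg, nsmul_eq_mul, nsmul_eq_mul, mul_one] at h2
  have : ((k : ℤ) : K) / ((p : ℕ) : K) = g ⟨c, hcS⟩ := by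
    rw [Int.cast_natCast, h2, mul_div_cancel_left₀ _ hp0]
  rw [this]
  exact hgX c hcS

theorem exists_eq_add_of_pnat_lt {a b : ℕ+} (h : a < b) : ∃ t, b = a + t :=
  ⟨b - a, (PNat.add_sub_of_lt h).symm⟩

/-! ### Torsion, regularity and divisibility in additive semigroups -/

section Mult

variable {A B : Type*} [AddCommSemigroup A] [AddCommSemigroup B]

theorem map_mult {f : A → B} (hf : ∀ x y, f (x + y) = f x + f y) (n : ℕ+) (a : A) :
    f (mult n a) = mult n (f a) := by
  induction n using PNat.recOn with
  | one => simp only [mult_one]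
  | succ n ih => rw [mult_add_one, mult_add_one, hf, ih]

theorem coe_mult (n : ℕ+) (a : A) :
    ((mult n a : A) : WithZero A) = (n : ℕ) • (a : WithZero A) := by
  rw [map_mult (f := ((↑) : A → WithZero A)) (fun _ _ => WithZero.coe_add _ _), mult_eq_nsmul]

theorem add_mult (m n : ℕ+) (a : A) : mult (m + n) a = mult m a + mult n a :=
  WithZero.coe_injective <| by
    rw [WithZero.coe_add, coe_mult, coe_mult, coe_mult, PNat.add_coe, add_nsmul]

theorem mult_add (n : ℕ+) (a b : A) : mult n (a + b) = mult n a + mult n b :=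
  WithZero.coe_injective <| by
    rw [WithZero.coe_add, coe_mult, coe_mult, coe_mult, WithZero.coe_add, nsmul_add]

theorem mul_mult (m n : ℕ+) (a : A) : mult (m * n) a = mult m (mult n a) :=
  WithZero.coe_injective <| by
    rw [coe_mult, coe_mult, coe_mult, PNat.mul_coe, mul_nsmul']

theorem add_mult_mul_eq {x a : A} {u : ℕ+} (h : x + mult u a = x) (n : ℕ+) :
    x + mult (u * n) a = x := by
  induction n using PNat.recOn with
  | one => rwa [_root_.mul_one]
  | succ n ih => rw [mul_add, _root_.mul_one, add_mult, ← add_assoc, ih, h]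

theorem isTorsionElem_of_mult_eq {a : A} {u v : ℕ+} (h : mult (u + v) a = mult v a) :
    IsTorsionElem a := by
  refine ((Set.finite_Iic (u + v)).image fun l => mult l a).subset ?_
  rintro _ ⟨l, rfl⟩
  induction l using PNat.strongInductionOn with
  | _ l ih =>
    rcases le_or_gt l (u + v) with hl | hl
    · exact ⟨l, hl, rfl⟩
    · obtain ⟨t, rfl⟩ := exists_eq_add_of_pnat_lt hl
      have : mult (u + v + t) a = mult (v + t) a := by rw [add_mult, h, ← add_mult]
      simp only [this]
      exact ih _ (by rw [add_assoc]; exact PNat.lt_add_left _ _)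

theorem IsTorsionElem.exists_mult_eq {a : A} (h : IsTorsionElem a) :
    ∃ u v : ℕ+, mult (u + v) a = mult v a := by
  have hinj : ¬ Function.Injective fun l : ℕ+ => mult l a := fun hi =>
    Set.infinite_range_of_injective hi h
  simp only [Function.Injective, not_forall] at hinj
  obtain ⟨l, m, hlm, hne⟩ := hinj
  rcases lt_or_gt_of_ne hne with hl | hl
  · obtain ⟨t, rfl⟩ := exists_eq_add_of_pnat_lt hl
    exact ⟨t, l, by rw [add_comm]; exact hlm.symm⟩
  · obtain ⟨t, rfl⟩ := exists_eq_add_of_pnat_lt hl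
    exact ⟨t, m, by rw [add_comm]; exact hlm⟩

theorem IsStronglyAlmostDivisibleElem.isAlmostDivisibleElem {a : A}
    (h : IsStronglyAlmostDivisibleElem a) : IsAlmostDivisibleElem a := ⟨1, h⟩

theorem IsTorsionElem.isAlmostDivisibleElem {a : A} (h : IsTorsionElem a) :
    IsAlmostDivisibleElem a := by
  obtain ⟨u, v, h⟩ := h.exists_mult_eq
  -- A multiple of the period `u` beyond the preperiod `v` gives an additive idempotent, divisible
  -- by every prime.
  obtain ⟨t, ht⟩ : ∃ t, u * (v + 1) = v + t := exists_eq_add_of_pnat_lt <| by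
    have : (v : ℕ) < u * (v + 1) := by nlinarith [u.pos]
    exact_mod_cast this
  have h1 : mult (v + t) a + mult u a = mult (v + t) a := by
    rw [← add_mult, add_comm _ u, ← add_assoc, add_mult, h, ← add_mult]
  have h2 := add_mult_mul_eq h1 (v + 1)
  rw [← ht] at h2
  have h3 : ∀ n : ℕ+, mult n (mult (u * (v + 1)) a) = mult (u * (v + 1)) a := fun n => by
    induction n using PNat.recOn with
    | one => rfl
    | succ n ih => rw [mult_add_one, ih, h2]
  exact ⟨u * (v + 1), Set.univ, Set.infinite_univ, fun p _ => ⟨_, (h3 p).symm⟩⟩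

theorem infinite_primes_gt (n : ℕ) : {p : Nat.Primes | n < p}.Infinite := by
  intro hfin
  obtain ⟨p, hp, hpp⟩ := Nat.exists_infinite_primes ((hfin.toFinset.sup fun p => (p : ℕ)) + n + 1)
  have := Finset.le_sup (f := fun p : Nat.Primes => (p : ℕ)) (b := ⟨p, hpp⟩)
    (hfin.mem_toFinset.2 (show n < p by omega))
  simp only at this
  change p ≤ _ at this
  omega

/-- Regularity removes the preperiod: `a` absorbs `a + b`, hence also `mult u a`. Euler's theorem
modulo `u` then makes `a` divisible by each prime above `u`. -/
theorem IsRegularElem.isStronglyAlmostDivisibleElem {a : A} (hr : IsRegularElem a)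
    (ht : IsTorsionElem a) : IsStronglyAlmostDivisibleElem a := by
  obtain ⟨b, hb⟩ := hr
  obtain ⟨u, v, h⟩ := ht.exists_mult_eq
  have h0 : a + mult v (a + b) = a := by
    have := add_mult_mul_eq (x := a) (a := a + b) (u := 1)
      (by rw [mult_one, add_comm]; exact hb.symm) v
    rwa [one_mul] at this
  have h1 : a + mult u a = a := by
    have : a + mult v (a + b) + mult u a = a + mult v (a + b) := by
      rw [mult_add, ← add_assoc, add_right_comm _ (mult v b), add_assoc a,
        ← add_mult, add_comm v u, h]
    rwa [h0] at this
  refine ⟨_, infinite_primes_gt u, fun p hp => ?_⟩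
  have hcop : Nat.Coprime p u :=
    p.2.coprime_iff_not_dvd.2 (Nat.not_dvd_of_pos_of_lt u.pos hp)
  have hφ : Nat.totient u ≠ 0 := (Nat.totient_pos.2 u.pos).ne'
  have hlt : 1 < (p : ℕ) ^ Nat.totient u := Nat.one_lt_pow hφ p.2.one_lt
  obtain ⟨t, ht⟩ := (Nat.modEq_iff_dvd' hlt.le).1 (Nat.ModEq.pow_totient hcop).symm
  have ht0 : 0 < t := Nat.pos_of_ne_zero fun h0 => by
    rw [h0, Nat.mul_zero] at ht; omega
  lift t to ℕ+ using ht0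
  have hp1 : (p : ℕ+) * (p : ℕ+) ^ (Nat.totient u - 1) = 1 + u * t := by
    rw [mul_pow_sub_one hφ]
    apply PNat.eq
    rw [PNat.pow_coe, PNat.add_coe, PNat.mul_coe, PNat.one_coe, ← ht]
    change (p : ℕ) ^ Nat.totient u = _
    omega
  refine ⟨mult ((p : ℕ+) ^ (Nat.totient u - 1)) a, ?_⟩
  rw [← mul_mult, hp1, add_mult, mult_one, add_mult_mul_eq h1]

end Mult

/-! ### Semirings with unity -/

section Semiring

theorem mult_eq_mult_one_mul {S : Type*} [AddCommSemigroup S]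
    [CommMonoid S] [RightDistribClass S] (n : ℕ+) (a : S) : mult n a = mult n 1 * a := by
  rw [map_mult (f := fun x => x * a) (fun x y => right_distrib x y a), one_mul]

theorem mult_eq_of_mult_one_eq {S : Type*} [AddCommSemigroup S] [CommMonoid S]
    [RightDistribClass S] {u v : ℕ+} (h : mult (u + v) (1 : S) = mult v 1) (a : S) :
    mult (u + v) a = mult v a := by
  rw [mult_eq_mult_one_mul, h, ← mult_eq_mult_one_mul]

variable {S : Type*} [AddCommSemigroup S] [CommMonoid S] [RightDistribClass S]

/-- Adjoining a zero to a commutative semiring with unity. -/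
noncomputable abbrev withZeroCommSemiring [LeftDistribClass S] : CommSemiring (WithZero S) :=
  { (inferInstance : AddCommMonoid (WithZero S)),
    (inferInstance : CommMonoidWithZero (WithZero S)) with
    left_distrib := left_distrib
    right_distrib := right_distrib }

/-- In a torsion semiring with unity, divisibility by infinitely many primes implies
regularity. -/
theorem IsStronglyAlmostDivisibleElem.isRegularElem {a : S}
    (ha : IsStronglyAlmostDivisibleElem a) (h1 : IsTorsionElem (1 : S)) : IsRegularElem a := by
  obtain ⟨u, v, h⟩ := h1.exists_mult_eq
  obtain ⟨P, hP, hdiv⟩ := ha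
  obtain ⟨p, hp, hvp⟩ : ∃ p ∈ P, (v : ℕ) < (p : ℕ) := by
    by_contra! hle
    exact hP ((Set.Finite.preimage (f := fun p : Nat.Primes => (p : ℕ))
      Nat.Primes.coe_nat_injective.injOn (Set.finite_Iic (v : ℕ))).subset hle)
  obtain ⟨c, hc⟩ := hdiv p hp
  obtain ⟨t, ht⟩ : ∃ t, (p : ℕ+) = v + t := exists_eq_add_of_pnat_lt (by exact_mod_cast hvp)
  -- As `p` exceeds the preperiod `v`, adding a period to `mult p c` changes nothing.
  have h2 : a + mult u c = a := by
    rw [hc, ht, ← add_mult, add_comm (v + t), ← add_assoc, add_mult (u + v),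
      mult_eq_of_mult_one_eq h, ← add_mult]
  have h3 : a + mult u a = a := by
    have := add_mult_mul_eq h2 p
    rwa [mul_mult, ← hc] at this
  -- Doubling covers `u = 1`: one copy of `a` is split off and a positive number must remain.
  have h4 := add_mult_mul_eq h3 2
  obtain ⟨w, hw⟩ : ∃ w : ℕ+, u * 2 = 1 + w := exists_eq_add_of_pnat_lt <| by
    have : 1 < (u : ℕ) * 2 := by have := u.pos; omega
    exact_mod_cast this
  rw [hw, add_comm 1 w, mult_add_one, ← add_assoc] at h4
  exact ⟨_, h4.symm⟩

variable [LeftDistribClass S] {V Γ : Type*} [AddCommGroup V] [Module.Finite ℤ V] [CommMonoid Γ]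

/-- Transfers the core result along `S → WithZero S`, which is injective. A general idempotent is
needed because the unity of a copy of `ℕ_P` need not be that of `S`. -/
theorem exists_mult_eq_of_idempotent (j : Γ →* Multiplicative V) (hj : Function.Injective j)
    (ψ : Γ →* S) (hψ : AddSubsemigroup.closure (Set.range ψ) = ⊤)
    {e : S} (he : e * e = e)
    (hdiv : IsAlmostDivisibleElem e) : ∃ u v : ℕ+, mult (u + v) e = mult v e := by
  let := withZeroCommSemiring (S := S)
  obtain ⟨k, P, hP, hdiv⟩ := hdiv
  let ψ' : Γ →* WithZero S :=
    { toFun := fun γ => (ψ γ : S)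
      map_one' := by rw [map_one]; rfl
      map_mul' := fun x y => by rw [map_mul]; rfl }
  have hψ' : AddSubmonoid.closure (Set.range ψ') = ⊤ := by
    rw [eq_top_iff]
    rintro x -
    induction x using WithZero.recZeroCoe with
    | zero => exact zero_mem _
    | coe s =>
      have hs : s ∈ AddSubsemigroup.closure (Set.range ψ) := hψ ▸ AddSubsemigroup.mem_top s
      induction hs using AddSubsemigroup.closure_induction with
      | mem x hx =>
        obtain ⟨γ, rfl⟩ := hx
        exact AddSubmonoid.subset_closure ⟨γ, rfl⟩
      | add x y _ _ hx hy => exact add_mem hx hy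
  obtain ⟨m, N, hm, h⟩ := exists_nsmul_add_nsmul_eq j hj ψ' hψ'
    (e := (e : WithZero S)) (congrArg _ he) hP k.ne_zero (fun p hp => by
      obtain ⟨c, hc⟩ := hdiv p hp
      refine ⟨c, ?_⟩
      have := congrArg (fun s : S => (s : WithZero S)) hc
      simp only [coe_mult] at this
      exact this)
  -- `N` may be zero, so one more copy of `e` is added to both sides.
  refine ⟨⟨m, Nat.pos_of_ne_zero hm⟩, N.succPNat, WithZero.coe_injective ?_⟩
  rw [coe_mult, coe_mult]
  change (m + (N + 1)) • (e : WithZero S) = (N + 1) • (e : WithZero S)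
  rw [← add_assoc, succ_nsmul, add_nsmul, succ_nsmul]
  exact congrArg (· + (e : WithZero S)) h

theorem isTorsionElem_one (j : Γ →* Multiplicative V) (hj : Function.Injective j)
    (ψ : Γ →* S) (hψ : AddSubsemigroup.closure (Set.range ψ) = ⊤)
    (h : AddAlmostDivisible S) : IsTorsionElem (1 : S) := by
  obtain ⟨u, v, h⟩ := exists_mult_eq_of_idempotent j hj ψ hψ (mul_one 1) (h 1)
  exact isTorsionElem_of_mult_eq h

theorem addAlmostDivisible_iff (j : Γ →* Multiplicative V) (hj : Function.Injective j)
    (ψ : Γ →* S) (hψ : AddSubsemigroup.closure (Set.range ψ) = ⊤) :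
    AddAlmostDivisible S ↔ AddTorsion S := by
  refine ⟨fun h a => ?_, fun h a => (h a).isAlmostDivisibleElem⟩
  obtain ⟨u, v, h⟩ := (isTorsionElem_one j hj ψ hψ h).exists_mult_eq
  exact isTorsionElem_of_mult_eq (mult_eq_of_mult_one_eq h a)

theorem addStronglyAlmostDivisible_iff (j : Γ →* Multiplicative V) (hj : Function.Injective j)
    (ψ : Γ →* S) (hψ : AddSubsemigroup.closure (Set.range ψ) = ⊤) :
    AddStronglyAlmostDivisible S ↔ AddRegular S ∧ AddTorsion S := by
  refine ⟨fun h => ?_, fun h a => (h.1 a).isStronglyAlmostDivisibleElem (h.2 a)⟩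
  have hS := (addAlmostDivisible_iff j hj ψ hψ).1 fun a => (h a).isAlmostDivisibleElem
  exact ⟨fun a => (h a).isRegularElem (hS 1), hS⟩

theorem not_containsCopyOf_primeFractions (j : Γ →* Multiplicative V) (hj : Function.Injective j)
    (ψ : Γ →* S) (hψ : AddSubsemigroup.closure (Set.range ψ) = ⊤)
    {P : Set Nat.Primes} (hP : P.Infinite) :
    ¬ ContainsCopyOf S (PrimeFractions P) := by
  rintro ⟨f, hf, hinj⟩
  have hval : ∀ (n : ℕ+) (x : PrimeFractions P), (mult n x).1 = (n : ℕ) • x.1 := fun n x => by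
    rw [← mult_eq_nsmul]
    exact map_mult (f := fun x : PrimeFractions P => x.1) (fun _ _ => rfl) n x
  let i : PrimeFractions P := ⟨1, 1, 1, one_pos, one_mem _, by simp⟩
  have hi : i * i = i := Subtype.ext (mul_one (1 : ℚ))
  obtain ⟨u, v, h⟩ := exists_mult_eq_of_idempotent j hj ψ hψ (e := f i)
    (by rw [← hf.map_mul, hi]) ⟨1, P, hP, fun p hp => by
      let r : PrimeFractions P := ⟨1 / (p : ℕ), 1, p, one_pos,
        Submonoid.subset_closure ⟨p, hp, rfl⟩, by simp⟩
      refine ⟨f r, ?_⟩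
      rw [← map_mult hf.map_add, ← map_mult hf.map_add, mult_one]
      refine congrArg f ?_
      apply Subtype.ext
      rw [hval]
      have : ((p : ℕ) : ℚ) ≠ 0 := by exact_mod_cast p.2.ne_zero
      change (1 : ℚ) = (p : ℕ) • (1 / ((p : ℕ) : ℚ))
      rw [nsmul_eq_mul, mul_one_div_cancel this]⟩
  rw [← map_mult hf.map_add, ← map_mult hf.map_add] at h
  have h' := congrArg Subtype.val (hinj h)
  rw [hval, hval, nsmul_eq_mul, nsmul_eq_mul] at h'
  change _ * (1 : ℚ) = _ * 1 at h'
  rw [mul_one, mul_one] at h'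
  have h2 : ((u + v : ℕ+) : ℕ) = v := by exact_mod_cast h'
  rw [PNat.add_coe] at h2
  have := u.pos
  omega

end Semiring

/-! ### Monomial generators and the main theorem -/

/-- Exponent vectors, viewed in the free abelian group. -/
noncomputable def exponentHom (σ : Type*) : Multiplicative (σ →₀ ℕ) →* Multiplicative (σ → ℤ) :=
  AddMonoidHom.toMultiplicative
    { toFun := fun f i => (f i : ℤ)
      map_zero' := by ext; simp
      map_add' := fun f g => by ext; simp }

theorem exponentHom_injective (σ : Type*) : Function.Injective (exponentHom σ) := by
  intro f g h
  apply Multiplicative.toAdd.injective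
  ext i
  exact Nat.cast_injective (R := ℤ) (congrFun (congrArg Multiplicative.toAdd h) i)

theorem FinGenSemiring.exists_generating_hom {T : Type*} [AddCommSemigroup T] [CommMonoid T]
    [LeftDistribClass T] [RightDistribClass T] (h : FinGenSemiring T) :
    ∃ (X : Set T) (ψ : Multiplicative (X →₀ ℕ) →* T), X.Finite ∧
      AddSubsemigroup.closure (Set.range ψ) = ⊤ := by
  obtain ⟨X, hX, hgen⟩ := h
  let ψ : Multiplicative (X →₀ ℕ) →* T := AddMonoidHom.toMultiplicativeLeft
    (Finsupp.liftAddHom fun x : X => multiplesHom (Additive T) (Additive.ofMul (x : T)))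
  refine ⟨X, ψ, hX, ?_⟩
  have hmul : ∀ x ∈ AddSubsemigroup.closure (Set.range ψ),
      ∀ y ∈ AddSubsemigroup.closure (Set.range ψ),
        x * y ∈ AddSubsemigroup.closure (Set.range ψ) := by
    intro x hx y hy
    induction hx using AddSubsemigroup.closure_induction with
    | mem x hx =>
      induction hy using AddSubsemigroup.closure_induction with
      | mem y hy =>
        obtain ⟨a, rfl⟩ := hx
        obtain ⟨b, rfl⟩ := hy
        exact AddSubsemigroup.subset_closure ⟨a * b, map_mul ψ a b⟩
      | add y z _ _ hy hz => rw [mul_add]; exact add_mem hy hz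
    | add x z _ _ hx hz => rw [add_mul]; exact add_mem hx hz
  refine SetLike.coe_injective (hgen _ (fun x hx => AddSubsemigroup.subset_closure
    ⟨Multiplicative.ofAdd (Finsupp.single ⟨x, hx⟩ 1), ?_⟩) (fun x hx y hy => add_mem hx hy) hmul)
  change Additive.toMul (Finsupp.liftAddHom _ _) = x
  simp

end AlmostDiv

theorem mainTheorem1 :
    (∀ (n : ℕ) (C : AddSubmonoid (Fin n →₀ ℕ))
      (S : Type*) [AddCommSemigroup S] [CommSemigroup S] [LeftDistribClass S] [RightDistribClass S],
      AlmostDiv.IsFactorOf S (AlmostDiv.MonoidSemiring C) →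
        (AlmostDiv.AddAlmostDivisible S ↔ AlmostDiv.AddTorsion S) ∧
        (AlmostDiv.AddStronglyAlmostDivisible S ↔
          AlmostDiv.AddRegular S ∧ AlmostDiv.AddTorsion S) ∧
        (∀ P : Set Nat.Primes, P.Infinite →
          ¬ AlmostDiv.ContainsCopyOf S (AlmostDiv.PrimeFractions P))) ∧
    (∀ (T : Type*) [AddCommSemigroup T] [CommMonoid T] [LeftDistribClass T] [RightDistribClass T],
      AlmostDiv.FinGenSemiring T →
        (AlmostDiv.AddTorsion T ↔ AlmostDiv.AddAlmostDivisible T)) := by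
  constructor
  · intro n C S _ _ _ _ ⟨f, hf, hsurj⟩
    have hmem (α : C) : MvPolynomial.monomial (α : Fin n →₀ ℕ) (1 : ℤ) ∈
        AlmostDiv.monoidSemiringSet C := AddSubsemigroup.subset_closure ⟨α, α.2, rfl⟩
    let x (α : C) : AlmostDiv.MonoidSemiring C := ⟨_, hmem α⟩
    have hx_add (α β : C) : x (α + β) = x α * x β :=
      Subtype.ext (by change MvPolynomial.monomial _ _ = MvPolynomial.monomial _ _ *
                          MvPolynomial.monomial _ _
                      simp [MvPolynomial.monomial_mul])
    have hx_zero (y : AlmostDiv.MonoidSemiring C) : x 0 * y = y :=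
      Subtype.ext (one_mul y.1)
    -- Since `0 ∈ C`, the constant monomial supplies a unity for every factor.
    have hone (s : S) : f (x 0) * s = s := by
      obtain ⟨y, rfl⟩ := hsurj s
      rw [← hf.map_mul, hx_zero]
    let : CommMonoid S :=
      { ‹CommSemigroup S› with
        one := f (x 0)
        one_mul := hone
        mul_one := fun s => (mul_comm s _).trans (hone s) }
    let ψ : Multiplicative C →* S :=
      { toFun := fun α => f (x α.toAdd)
        map_one' := rfl
        map_mul' := fun α β => by rw [toAdd_mul, hx_add, hf.map_mul] }
    have hψ : AddSubsemigroup.closure (Set.range ψ) = ⊤ := by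
      rw [eq_top_iff]
      rintro s -
      obtain ⟨⟨y, hy⟩, rfl⟩ := hsurj s
      induction hy using AddSubsemigroup.closure_induction with
      | mem y hy =>
        obtain ⟨α, hα, rfl⟩ := hy
        exact AddSubsemigroup.subset_closure ⟨Multiplicative.ofAdd ⟨α, hα⟩, rfl⟩
      | add y z hy' hz' hy hz =>
        have : f ⟨y + z, add_mem hy' hz'⟩ = f ⟨y, hy'⟩ + f ⟨z, hz'⟩ := hf.map_add ⟨y, hy'⟩ ⟨z, hz'⟩
        rw [this]
        exact add_mem hy hz
    let j := (AlmostDiv.exponentHom (Fin n)).comp (AddMonoidHom.toMultiplicative C.subtype)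
    have hj : Function.Injective j :=
      (AlmostDiv.exponentHom_injective _).comp Subtype.val_injective
    exact ⟨AlmostDiv.addAlmostDivisible_iff j hj ψ hψ,
      AlmostDiv.addStronglyAlmostDivisible_iff j hj ψ hψ,
      fun P hP => AlmostDiv.not_containsCopyOf_primeFractions j hj ψ hψ hP⟩
  · intro T _ _ _ _ hT
    obtain ⟨X, ψ, hX, hψ⟩ := hT.exists_generating_hom
    have := hX.to_subtype
    exact (AlmostDiv.addAlmostDivisible_iff _ (AlmostDiv.exponentHom_injective X) ψ hψ).symm
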